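/- Let $p,d,K,n\ge 1$ be integers, $\mu\ge 0$ and $\delta\in(0,1)$. Let $\mathcal X\subset\mathbb R^p$ be compact with $\max_{x\in\mathcal X}\|x\|_\infty=\bar X>0$, let $(X,Y)$ be a random pair with values in $\mathcal X\times\mathcal Y$, where $\mathcal Y$ is a measurable space, and let $S=\{(x^s,y^s)\}_{s=1}^n$ be independent samples, each distributed as $(X,Y)$. Let $\varphi:\mathbb R^d\times\mathcal Y\to\mathbb R$ be such that $\varphi(z;\cdot)$ is measurable for every $z$ and, for some $L_\varphi>0$, $C_\varphi>0$, $z_0\in\mathbb R^d$ and every $y\in\mathcal Y$, the function $\varphi(\cdot;y)$ is Lipschitz continuous on $\mathbb R^d$ with modulus $L_\varphi$ for the Euclidean norm $\|\cdot\|$, and $|\varphi(z_0;y)|\le C_\varphi$. Let $\mathcal H_\mu^K$ be the class of all piecewise affine decision rules $f=(f_1,\dots,f_d):\mathcal X\to\mathbb R^d$ of the form $$f_\iota(x)=\max_{1\le k\le K}\{(\alpha_\iota^k)^\top x+a_\iota^k\}-\max_{1\le k\le K}\{(\beta_\iota^k)^\top x+b_\iota^k\},\qquad \iota=1,\dots,d,$$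 with $\alpha_\iota^k,\beta_\iota^k\in\mathbb R^p$ and $a_\iota^k,b_\iota^k\in\mathbb R$ all of whose entries have absolute value at most $\mu$. Put $$R(f)=\mathbb E[\varphi(f(X);Y)],\qquad \widehat R_S(f)=\frac1n\sum_{s=1}^n\varphi(f(x^s);y^s),\qquad M_\mu=C_\varphi+L_\varphi\bigl(2\sqrt d\,\mu(p\bar X+1)+\|z_0\|\bigr).$$ Then $R(f)$ is well defined (that is, $\varphi(f(X);Y)$ is integrable) for every $f\in\mathcal H_\mu^K$, the maximum $\max_{f\in\mathcal H_\mu^K}|R(f)-\widehat R_S(f)|$ is attained for every sample and is a random variable, and with probability at least $1-\delta$ over the draw of $S$, $$\max_{f\in\mathcal H_\mu^K}\bigl|R(f)-\widehat R_S(f)\bigr|\le\frac{8\mu L_\varphi\sqrt{2dK(p+1)(p\bar X^2+1)}}{n}+2M_\mu\sqrt{\frac{2dK(p+1)\log n}{n}}+\sqrt2\,M_\mu\sqrt{\frac{\log(2/\delta)}{n}}.$$ -/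

import Mathlib

open MeasureTheory ProbabilityTheory
open scoped NNReal

noncomputable section

namespace PADR

/-- The parameter `(α^k, a^k, β^k, b^k)_{k ∈ [K]}` of one scalar piecewise affine function on `ℝ^p`.
Norms of `Fin _ → _` and of products are maxima, so `‖θ‖` is the maximum `‖θ‖_∞` of the absolute
values of all `2 K (p + 1)` entries. -/
abbrev Param (p K : ℕ) : Type := Fin K → (Fin p → ℝ) × ℝ × (Fin p → ℝ) × ℝ

/-- `x ↦ max_k (α^k · x + a^k) - max_k (β^k · x + b^k)` (the suprema range over the finite set
`Fin K`, so they are maxima for `K ≥ 1`). -/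
def paFun {p K : ℕ} (θ : Param p K) (x : Fin p → ℝ) : ℝ :=
  (⨆ k : Fin K, ((θ k).1 ⬝ᵥ x + (θ k).2.1)) - ⨆ k : Fin K, ((θ k).2.2.1 ⬝ᵥ x + (θ k).2.2.2)

/-- The class of piecewise affine decision rules `𝒳 → ℝ^d` whose `d` coordinates are differences of
two max-affine functions with `K` pieces each, all parameters being at most `μ` in absolute value. -/
def ruleClass {p : ℕ} (𝒳 : Set (Fin p → ℝ)) (d K : ℕ) (μ : ℝ) :
    Set (𝒳 → EuclideanSpace ℝ (Fin d)) :=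
  {f | ∃ θ : Fin d → Param p K, (∀ ι, ‖θ ι‖ ≤ μ) ∧ ∀ (x : 𝒳) (ι : Fin d), f x ι = paFun (θ ι) x}

/-- The expected cost `R(f) = E[φ(f(X); Y)]`, where `D` is the joint law of `(X, Y)`. -/
def risk {F Y Z : Type*} [MeasurableSpace F] [MeasurableSpace Y]
    (D : Measure (F × Y)) (φ : Z → Y → ℝ) (f : F → Z) : ℝ :=
  ∫ w, φ (f w.1) w.2 ∂D

/-- The empirical cost `(1/n) ∑_s φ(f(x^s); y^s)` of the sample `S = ((x^s, y^s))_s`. -/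
def empRisk {F Y Z : Type*} {n : ℕ} (φ : Z → Y → ℝ) (S : Fin n → F × Y) (f : F → Z) : ℝ :=
  (1 / (n : ℝ)) * ∑ s, φ (f (S s).1) (S s).2

/-- The set of all gaps `|R(f) - R̂_S(f)|` for `f` in the class `H`. -/
def gaps {F Y Z : Type*} [MeasurableSpace F] [MeasurableSpace Y] {n : ℕ}
    (D : Measure (F × Y)) (φ : Z → Y → ℝ) (H : Set (F → Z)) (S : Fin n → F × Y) : Set ℝ :=
  (fun f => |risk D φ f - empRisk φ S f|) '' H

/-- The uniform gap `sup_{f ∈ H} |R(f) - R̂_S(f)|`. -/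
def uniformGap {F Y Z : Type*} [MeasurableSpace F] [MeasurableSpace Y] {n : ℕ}
    (D : Measure (F × Y)) (φ : Z → Y → ℝ) (H : Set (F → Z)) (S : Fin n → F × Y) : ℝ :=
  sSup (gaps D φ H S)

/-- `M_μ = C_φ + L_φ (2 √d μ (p X̄ + 1) + ‖z₀‖)`. -/
def costBound (p d : ℕ) (μ Xbar L C : ℝ) (z₀ : EuclideanSpace ℝ (Fin d)) : ℝ :=
  C + L * (2 * √(d : ℝ) * μ * (p * Xbar + 1) + ‖z₀‖)

end PADR

end

namespace PADR

section Deterministic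

variable {p d K : ℕ}

lemma abs_ciSup_sub_ciSup_le {ι : Type*} [Finite ι] [Nonempty ι] {f g : ι → ℝ} {c : ℝ}
    (h : ∀ i, |f i - g i| ≤ c) : |(⨆ i, f i) - ⨆ i, g i| ≤ c := by
  have key : ∀ f g : ι → ℝ, (∀ i, |f i - g i| ≤ c) → (⨆ i, f i) ≤ (⨆ i, g i) + c :=
    fun f g h => ciSup_le fun i => by
      have h1 := le_ciSup (Set.finite_range g).bddAbove i
      have h2 := (abs_le.1 (h i)).2
      linarith
  have h1 := key f g h
  have h2 := key g f fun i => by rw [abs_sub_comm]; exact h i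
  exact abs_le.2 ⟨by linarith, by linarith⟩

lemma abs_dotProduct_le (u v : Fin p → ℝ) : |u ⬝ᵥ v| ≤ p * (‖u‖ * ‖v‖) := by
  calc |u ⬝ᵥ v| ≤ ∑ i, |u i * v i| := Finset.abs_sum_le_sum_abs _ _
    _ ≤ ∑ _i : Fin p, ‖u‖ * ‖v‖ := Finset.sum_le_sum fun i _ => by
        rw [abs_mul]
        exact mul_le_mul (norm_le_pi_norm u i) (norm_le_pi_norm v i) (abs_nonneg _) (norm_nonneg _)
    _ = p * (‖u‖ * ‖v‖) := by simp

lemma abs_affine_sub_affine_le (u v x : Fin p → ℝ) (a b : ℝ) {r : ℝ} (h₁ : ‖u - v‖ ≤ r)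
    (h₂ : |a - b| ≤ r) : |(u ⬝ᵥ x + a) - (v ⬝ᵥ x + b)| ≤ (p * ‖x‖ + 1) * r := by
  have e : (u ⬝ᵥ x + a) - (v ⬝ᵥ x + b) = (u - v) ⬝ᵥ x + (a - b) := by
    rw [sub_dotProduct]; ring
  rw [e]
  calc |(u - v) ⬝ᵥ x + (a - b)| ≤ |(u - v) ⬝ᵥ x| + |a - b| := abs_add_le _ _
    _ ≤ p * (r * ‖x‖) + r := by
        gcongr
        exact (abs_dotProduct_le _ _).trans (by gcongr)
    _ = (p * ‖x‖ + 1) * r := by ring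

lemma abs_paFun_sub_paFun_le [NeZero K] (θ θ' : Param p K) (x : Fin p → ℝ) :
    |paFun θ x - paFun θ' x| ≤ 2 * (p * ‖x‖ + 1) * ‖θ - θ'‖ := by
  have hk : ∀ k, ‖(θ - θ') k‖ ≤ ‖θ - θ'‖ := fun k => norm_le_pi_norm (θ - θ') k
  have h1 : |(⨆ k : Fin K, ((θ k).1 ⬝ᵥ x + (θ k).2.1)) - ⨆ k : Fin K, ((θ' k).1 ⬝ᵥ x + (θ' k).2.1)|
      ≤ (p * ‖x‖ + 1) * ‖θ - θ'‖ :=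
    abs_ciSup_sub_ciSup_le fun k => abs_affine_sub_affine_le _ _ _ _ _
      ((norm_fst_le _).trans (hk k)) ((norm_fst_le _).trans ((norm_snd_le _).trans (hk k)))
  have h2 : |(⨆ k : Fin K, ((θ k).2.2.1 ⬝ᵥ x + (θ k).2.2.2)) -
      ⨆ k : Fin K, ((θ' k).2.2.1 ⬝ᵥ x + (θ' k).2.2.2)| ≤ (p * ‖x‖ + 1) * ‖θ - θ'‖ :=
    abs_ciSup_sub_ciSup_le fun k => abs_affine_sub_affine_le _ _ _ _ _
      ((norm_fst_le _).trans ((norm_snd_le _).trans ((norm_snd_le _).trans (hk k))))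
      ((norm_snd_le _).trans ((norm_snd_le _).trans ((norm_snd_le _).trans (hk k))))
  unfold paFun
  rw [abs_le] at *
  constructor <;> linarith [h1.1, h1.2, h2.1, h2.2]

lemma paFun_zero (x : Fin p → ℝ) : paFun (0 : Param p K) x = 0 := by
  simp [paFun]

lemma continuous_paFun [NeZero K] (θ : Param p K) : Continuous (paFun θ) := by
  have h : ∀ (u : Fin K → Fin p → ℝ) (a : Fin K → ℝ),
      Continuous fun x : Fin p → ℝ => ⨆ k, (u k ⬝ᵥ x + a k) := fun u a => by
    simp_rw [← Finset.sup'_univ_eq_ciSup]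
    refine Continuous.finset_sup'_apply Finset.univ_nonempty fun k _ => ?_
    unfold dotProduct
    fun_prop
  exact (h _ _).sub (h _ _)

/-- The decision rule with parameter `θ`. -/
noncomputable def rule (𝒳 : Set (Fin p → ℝ)) (θ : Fin d → Param p K) (x : 𝒳) :
    EuclideanSpace ℝ (Fin d) :=
  WithLp.toLp 2 fun ι => paFun (θ ι) x

lemma ruleClass_eq_image (𝒳 : Set (Fin p → ℝ)) {μ : ℝ} (hμ : 0 ≤ μ) :
    ruleClass 𝒳 d K μ = rule 𝒳 '' Metric.closedBall (0 : Fin d → Param p K) μ := by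
  ext f
  simp only [ruleClass, Set.mem_ofPred_eq, Set.mem_image, mem_closedBall_zero_iff,
    pi_norm_le_iff_of_nonneg hμ (x := (_ : Fin d → Param p K))]
  refine exists_congr fun θ => and_congr_right fun _ => ⟨fun h => ?_, ?_⟩
  · funext x
    ext ι
    exact (h x ι).symm
  · rintro rfl x ι
    rfl

lemma euclideanNorm_le_sqrt_mul (v : EuclideanSpace ℝ (Fin d)) {c : ℝ} (hc : 0 ≤ c)
    (h : ∀ i, |v i| ≤ c) : ‖v‖ ≤ √d * c := by
  rw [EuclideanSpace.norm_eq, ← Real.sqrt_sq hc, ← Real.sqrt_mul (Nat.cast_nonneg _)]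
  refine Real.sqrt_le_sqrt ?_
  calc ∑ i, ‖v i‖ ^ 2 ≤ ∑ _i : Fin d, c ^ 2 := Finset.sum_le_sum fun i _ => by
        have := h i
        rw [Real.norm_eq_abs]
        gcongr
    _ = d * c ^ 2 := by simp

lemma norm_rule_sub_rule_le [NeZero K] {𝒳 : Set (Fin p → ℝ)} {B : ℝ} (hB : ∀ x ∈ 𝒳, ‖x‖ ≤ B)
    (θ θ' : Fin d → Param p K) (x : 𝒳) :
    ‖rule 𝒳 θ x - rule 𝒳 θ' x‖ ≤ √d * (2 * (p * B + 1) * ‖θ - θ'‖) := by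
  have hB0 : 0 ≤ B := (norm_nonneg _).trans (hB x x.2)
  refine euclideanNorm_le_sqrt_mul _ (by positivity) fun i => ?_
  refine (abs_paFun_sub_paFun_le (θ i) (θ' i) x).trans ?_
  have h1 := hB x x.2
  have h2 := norm_le_pi_norm (θ - θ') i
  rw [Pi.sub_apply] at h2
  gcongr

lemma norm_rule_le [NeZero K] {𝒳 : Set (Fin p → ℝ)} {B : ℝ} (hB : ∀ x ∈ 𝒳, ‖x‖ ≤ B)
    (θ : Fin d → Param p K) (x : 𝒳) :
    ‖rule 𝒳 θ x‖ ≤ √d * (2 * (p * B + 1) * ‖θ‖) := by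
  have h0 : rule 𝒳 (0 : Fin d → Param p K) x = 0 := by
    ext i
    exact paFun_zero _
  simpa [h0] using norm_rule_sub_rule_le hB θ 0 x

lemma continuous_rule [NeZero K] (𝒳 : Set (Fin p → ℝ)) (θ : Fin d → Param p K) :
    Continuous (rule 𝒳 θ) :=
  (PiLp.continuous_toLp 2 _).comp
    (continuous_pi fun ι => (continuous_paFun (θ ι)).comp continuous_subtype_val)

lemma exists_fin_abs_sub_le {n : ℕ} (hn : 1 ≤ n) {μ : ℝ} (hμ : 0 ≤ μ) :
    ∃ c : Fin n → ℝ, (∀ i, |c i| ≤ μ) ∧ ∀ t, |t| ≤ μ → ∃ i, |t - c i| ≤ μ / n := by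
  have hn0 : (0 : ℝ) < n := by exact_mod_cast hn
  refine ⟨fun i => μ / n * (2 * i + 1 - n), fun i => ?_, fun t ht => ?_⟩
  · have hi : (i : ℝ) + 1 ≤ n := by exact_mod_cast i.2
    have h : |(2 * i + 1 - n : ℝ)| ≤ n := abs_le.2 ⟨by linarith [(i : ℕ).cast_nonneg (α := ℝ)], by linarith⟩
    rw [abs_mul, abs_of_nonneg (by positivity : 0 ≤ μ / n)]
    calc μ / n * |(2 * i + 1 - n : ℝ)| ≤ μ / n * n := by gcongr
      _ = μ := by field_simp
  · obtain rfl | hμ' := hμ.eq_or_lt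
    · exact ⟨⟨0, hn⟩, by simpa using ht⟩
    set s : ℝ := (t + μ) * n / (2 * μ) with hs
    have hts : t = μ / n * (2 * s - n) := by rw [hs]; field_simp; ring
    obtain ⟨ht1, ht2⟩ := abs_le.1 ht
    have hs0 : 0 ≤ s := div_nonneg (mul_nonneg (by linarith) hn0.le) (by linarith)
    have hsn : s ≤ n := by
      rw [hs, div_le_iff₀ (by linarith)]
      nlinarith
    have key : ∃ i : Fin n, (i : ℝ) ≤ s ∧ s ≤ i + 1 := by
      obtain h | h := hsn.lt_or_eq
      · exact ⟨⟨⌊s⌋₊, (Nat.floor_lt hs0).2 h⟩, Nat.floor_le hs0, (Nat.lt_floor_add_one s).le⟩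
      · refine ⟨⟨n - 1, by omega⟩, ?_, ?_⟩ <;> simp [Nat.cast_sub hn, h]
    obtain ⟨i, h1, h2⟩ := key
    refine ⟨i, ?_⟩
    rw [hts, ← mul_sub, abs_mul, abs_of_nonneg (by positivity : 0 ≤ μ / n)]
    have : |2 * s - n - (2 * i + 1 - n : ℝ)| ≤ 1 := abs_le.2 ⟨by linarith, by linarith⟩
    exact mul_le_of_le_one_right (by positivity) this

/-- The parameter cube has a net of radius `μ / n` with `n ^ (2 d K (p + 1))` points. -/
lemma exists_param_net {n : ℕ} (hn : 1 ≤ n) {μ : ℝ} (hμ : 0 ≤ μ) :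
    ∃ c : Fin (n ^ (2 * d * K * (p + 1))) → Fin d → Param p K,
      (∀ i, ‖c i‖ ≤ μ) ∧ ∀ θ, ‖θ‖ ≤ μ → ∃ i, ‖θ - c i‖ ≤ μ / n := by
  obtain ⟨c, hc, hcn⟩ := exists_fin_abs_sub_le hn hμ
  have : NeZero n := ⟨by omega⟩
  choose! idx hidx using hcn
  have hr : 0 ≤ μ / n := by positivity
  let J := Fin d → Fin K → (Fin p → Fin n) × Fin n × (Fin p → Fin n) × Fin n
  let net : J → Fin d → Param p K := fun j ι k =>
    (fun i => c ((j ι k).1 i), c (j ι k).2.1, fun i => c ((j ι k).2.2.1 i), c (j ι k).2.2.2)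
  have hcard : Fintype.card J = n ^ (2 * d * K * (p + 1)) := by
    simp only [J, Fintype.card_pi, Fintype.card_prod, Fintype.card_fin, Finset.prod_const,
      Finset.card_univ]
    rw [← pow_mul, ← pow_succ, ← mul_assoc, ← pow_succ, ← pow_add, ← pow_mul]
    congr 1
    ring
  let e : Fin (n ^ (2 * d * K * (p + 1))) ≃ J := (Fintype.equivFinOfCardEq hcard).symm
  refine ⟨net ∘ e, fun i => ?_, fun θ hθ => ?_⟩
  · simp only [Function.comp, net, pi_norm_le_iff_of_nonneg hμ, Prod.norm_mk, max_le_iff,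
      Real.norm_eq_abs, hc, implies_true, and_self]
  · simp only [pi_norm_le_iff_of_nonneg hμ, Prod.norm_def, max_le_iff, Real.norm_eq_abs] at hθ
    let j : J := fun ι k => (fun i => idx ((θ ι k).1 i), idx (θ ι k).2.1,
      fun i => idx ((θ ι k).2.2.1 i), idx (θ ι k).2.2.2)
    refine ⟨e.symm j, ?_⟩
    simp only [Function.comp, Equiv.apply_symm_apply, net, j, pi_norm_le_iff_of_nonneg hr,
      Prod.norm_def, max_le_iff, Real.norm_eq_abs, Pi.sub_apply, Prod.fst_sub, Prod.snd_sub]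
    exact fun ι k => ⟨fun i => hidx _ ((hθ ι k).1 i), hidx _ (hθ ι k).2.1,
      fun i => hidx _ ((hθ ι k).2.2.1 i), hidx _ (hθ ι k).2.2.2⟩

end Deterministic

/-- **Two-sided Hoeffding inequality** for the empirical mean of a bounded function of an
i.i.d. sample. -/
lemma measureReal_le_abs_integral_sub_mean_le {Ω E : Type*} [MeasurableSpace Ω] [MeasurableSpace E]
    {n : ℕ} (hn : 1 ≤ n) {D : Measure E} {P : Measure Ω} [IsProbabilityMeasure P]
    {S : Fin n → Ω → E} (hSm : ∀ s, Measurable (S s)) (hSlaw : ∀ s, P.map (S s) = D)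
    (hSindep : iIndepFun S P) {g : E → ℝ} (hg : Measurable g) {M : ℝ} (hM : 0 < M)
    (hgM : ∀ e, |g e| ≤ M) {t : ℝ} (ht : 0 ≤ t) :
    P.real {ω | t ≤ |∫ e, g e ∂D - 1 / (n : ℝ) * ∑ s, g (S s ω)|} ≤
      2 * Real.exp (-(n * t ^ 2 / (2 * M ^ 2))) := by
  have hn0 : (0 : ℝ) < n := by exact_mod_cast hn
  set m := ∫ e, g e ∂D with hm
  have hmean : ∀ s, ∫ ω, g (S s ω) ∂P = m := fun s => by
    rw [hm, ← hSlaw s, integral_map (hSm s).aemeasurable hg.aestronglyMeasurable]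
  have hsub : ∀ s, HasSubgaussianMGF (fun ω => g (S s ω) - m) ((‖M - -M‖₊ / 2) ^ 2) P := fun s => by
    rw [← hmean s]
    exact hasSubgaussianMGF_of_mem_Icc (hg.comp (hSm s)).aemeasurable
      (ae_of_all _ fun ω => abs_le.1 (hgM _))
  have hc : (((‖M - -M‖₊ / 2) ^ 2 : ℝ≥0) : ℝ) = M ^ 2 := by
    rw [NNReal.coe_pow, NNReal.coe_div, coe_nnnorm, Real.norm_eq_abs,
      abs_of_pos (by linarith : 0 < M - -M)]
    norm_num
  have hexp : -(n * t) ^ 2 / (2 * ∑ _s : Fin n, (((‖M - -M‖₊ / 2) ^ 2 : ℝ≥0) : ℝ)) =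
      -(n * t ^ 2 / (2 * M ^ 2)) := by
    rw [Finset.sum_const, Finset.card_univ, Fintype.card_fin, nsmul_eq_mul, hc]
    field_simp
  have hind : iIndepFun (fun s ω => g (S s ω) - m) P :=
    hSindep.comp (fun _ e => g e - m) fun _ => hg.sub_const _
  have hind' : iIndepFun (fun s => -(fun ω => g (S s ω) - m)) P :=
    hSindep.comp (fun _ e => -(g e - m)) fun _ => (hg.sub_const _).neg
  have h1 := HasSubgaussianMGF.measure_sum_ge_le_of_iIndepFun hind (s := Finset.univ)
    (fun s _ => hsub s) (mul_nonneg hn0.le ht)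
  have h2 := HasSubgaussianMGF.measure_sum_ge_le_of_iIndepFun hind' (s := Finset.univ)
    (fun s _ => (hsub s).neg) (mul_nonneg hn0.le ht)
  rw [NNReal.coe_sum, hexp] at h1 h2
  rw [two_mul]
  refine le_trans (le_trans (measureReal_mono ?_) (measureReal_union_le _ _)) (add_le_add h1 h2)
  intro ω hω
  have hω' : t ≤ |m - 1 / (n : ℝ) * ∑ s, g (S s ω)| := hω
  have e1 : ∑ s, (g (S s ω) - m) = ∑ s, g (S s ω) - n * m := by simp
  have e2 : (n : ℝ) * (1 / n * ∑ s, g (S s ω)) = ∑ s, g (S s ω) := by field_simp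
  simp only [Set.mem_union, Set.mem_ofPred_eq, Pi.neg_apply, Finset.sum_neg_distrib, e1]
  rcases le_abs.1 hω' with h | h
  · right
    have := mul_le_mul_of_nonneg_left h hn0.le
    linarith
  · left
    have := mul_le_mul_of_nonneg_left h hn0.le
    linarith

section Cost

variable {𝒴 : Type*} {p d K n : ℕ} {𝒳 : Set (Fin p → ℝ)} {B : ℝ}
  {φ : EuclideanSpace ℝ (Fin d) → 𝒴 → ℝ} {L : ℝ≥0} {C : ℝ} {z₀ : EuclideanSpace ℝ (Fin d)}

lemma abs_cost_sub_cost_le [NeZero K] (hB : ∀ x ∈ 𝒳, ‖x‖ ≤ B)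
    (hφL : ∀ y, LipschitzWith L (fun z => φ z y)) (θ θ' : Fin d → Param p K) (w : 𝒳 × 𝒴) :
    |φ (rule 𝒳 θ w.1) w.2 - φ (rule 𝒳 θ' w.1) w.2| ≤
      L * (√d * (2 * (p * B + 1) * ‖θ - θ'‖)) := by
  have h := (hφL w.2).dist_le_mul (rule 𝒳 θ w.1) (rule 𝒳 θ' w.1)
  rw [Real.dist_eq, dist_eq_norm] at h
  exact h.trans (mul_le_mul_of_nonneg_left (norm_rule_sub_rule_le hB θ θ' w.1) L.2)

lemma abs_cost_le [NeZero K] (hB0 : 0 ≤ B) (hB : ∀ x ∈ 𝒳, ‖x‖ ≤ B)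
    (hφL : ∀ y, LipschitzWith L (fun z => φ z y)) (hφC : ∀ y, |φ z₀ y| ≤ C)
    {θ : Fin d → Param p K} {μ : ℝ} (hθ : ‖θ‖ ≤ μ) (w : 𝒳 × 𝒴) :
    |φ (rule 𝒳 θ w.1) w.2| ≤ costBound p d μ B L C z₀ := by
  have h := (hφL w.2).dist_le_mul (rule 𝒳 θ w.1) z₀
  rw [Real.dist_eq, dist_eq_norm] at h
  have h1 : ‖rule 𝒳 θ w.1 - z₀‖ ≤ √d * (2 * (p * B + 1) * μ) + ‖z₀‖ :=
    (norm_sub_le _ _).trans (by gcongr; exact (norm_rule_le hB θ w.1).trans (by gcongr))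
  calc |φ (rule 𝒳 θ w.1) w.2|
      ≤ |φ z₀ w.2| + |φ (rule 𝒳 θ w.1) w.2 - φ z₀ w.2| := by
        simpa using abs_add_le (φ z₀ w.2) (φ (rule 𝒳 θ w.1) w.2 - φ z₀ w.2)
    _ ≤ C + L * (√d * (2 * (p * B + 1) * μ) + ‖z₀‖) :=
        add_le_add (hφC _) (h.trans (mul_le_mul_of_nonneg_left h1 L.2))
    _ = costBound p d μ B L C z₀ := by unfold costBound; ring

variable [MeasurableSpace 𝒴]

lemma measurable_cost [NeZero K] (hφm : ∀ z, Measurable (φ z))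
    (hφL : ∀ y, LipschitzWith L (fun z => φ z y)) (θ : Fin d → Param p K) :
    Measurable fun w : 𝒳 × 𝒴 => φ (rule 𝒳 θ w.1) w.2 :=
  (measurable_uncurry_of_continuous_of_measurable (fun y => (hφL y).continuous) hφm).comp
    (((continuous_rule 𝒳 θ).measurable.comp measurable_fst).prodMk measurable_snd)

lemma integrable_cost [NeZero K] {D : Measure (𝒳 × 𝒴)} [IsFiniteMeasure D] (hB0 : 0 ≤ B)
    (hB : ∀ x ∈ 𝒳, ‖x‖ ≤ B) (hφm : ∀ z, Measurable (φ z))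
    (hφL : ∀ y, LipschitzWith L (fun z => φ z y)) (hφC : ∀ y, |φ z₀ y| ≤ C)
    (θ : Fin d → Param p K) : Integrable (fun w : 𝒳 × 𝒴 => φ (rule 𝒳 θ w.1) w.2) D :=
  Integrable.of_bound (measurable_cost hφm hφL θ).aestronglyMeasurable _
    (ae_of_all _ fun w => abs_cost_le hB0 hB hφL hφC le_rfl w)

/-- The gap between the expected and the empirical cost of the rule with parameter `θ`. -/
noncomputable def ruleGap (D : Measure (𝒳 × 𝒴)) (φ : EuclideanSpace ℝ (Fin d) → 𝒴 → ℝ)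
    (T : Fin n → 𝒳 × 𝒴) (θ : Fin d → Param p K) : ℝ :=
  |risk D φ (rule 𝒳 θ) - empRisk φ T (rule 𝒳 θ)|

lemma abs_ruleGap_sub_ruleGap_le [NeZero K] (hn : 1 ≤ n) {D : Measure (𝒳 × 𝒴)}
    [IsProbabilityMeasure D] (hB0 : 0 ≤ B) (hB : ∀ x ∈ 𝒳, ‖x‖ ≤ B) (hφm : ∀ z, Measurable (φ z))
    (hφL : ∀ y, LipschitzWith L (fun z => φ z y)) (hφC : ∀ y, |φ z₀ y| ≤ C)
    (T : Fin n → 𝒳 × 𝒴) (θ θ' : Fin d → Param p K) :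
    |ruleGap D φ T θ - ruleGap D φ T θ'| ≤ 4 * L * √d * (p * B + 1) * ‖θ - θ'‖ := by
  have hn0 : (0 : ℝ) < n := by exact_mod_cast hn
  set r := L * (√d * (2 * (p * B + 1) * ‖θ - θ'‖)) with hr
  have h1 : |risk D φ (rule 𝒳 θ) - risk D φ (rule 𝒳 θ')| ≤ r := by
    unfold risk
    rw [← integral_sub (integrable_cost hB0 hB hφm hφL hφC θ)
      (integrable_cost hB0 hB hφm hφL hφC θ')]
    have h := norm_integral_le_of_norm_le_const (μ := D) (C := r)
      (f := fun w => φ (rule 𝒳 θ w.1) w.2 - φ (rule 𝒳 θ' w.1) w.2)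
      (ae_of_all _ fun w => abs_cost_sub_cost_le hB hφL θ θ' w)
    simpa using h
  have h2 : |empRisk φ T (rule 𝒳 θ) - empRisk φ T (rule 𝒳 θ')| ≤ r := by
    unfold empRisk
    rw [← mul_sub, ← Finset.sum_sub_distrib, abs_mul, abs_of_nonneg (by positivity)]
    calc _ ≤ 1 / (n : ℝ) * ∑ _s : Fin n, r := by
          gcongr
          exact (Finset.abs_sum_le_sum_abs _ _).trans
            (Finset.sum_le_sum fun s _ => abs_cost_sub_cost_le hB hφL θ θ' (T s))
      _ = r := by simp; field_simp
  calc |ruleGap D φ T θ - ruleGap D φ T θ'|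
      ≤ |(risk D φ (rule 𝒳 θ) - empRisk φ T (rule 𝒳 θ)) -
          (risk D φ (rule 𝒳 θ') - empRisk φ T (rule 𝒳 θ'))| := abs_abs_sub_abs_le _ _
    _ = |(risk D φ (rule 𝒳 θ) - risk D φ (rule 𝒳 θ')) -
          (empRisk φ T (rule 𝒳 θ) - empRisk φ T (rule 𝒳 θ'))| := by congr 1; ring
    _ ≤ r + r := (abs_sub _ _).trans (add_le_add h1 h2)
    _ = 4 * L * √d * (p * B + 1) * ‖θ - θ'‖ := by rw [hr]; ring

lemma continuous_ruleGap [NeZero K] (hn : 1 ≤ n) {D : Measure (𝒳 × 𝒴)}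
    [IsProbabilityMeasure D] (hB0 : 0 ≤ B) (hB : ∀ x ∈ 𝒳, ‖x‖ ≤ B) (hφm : ∀ z, Measurable (φ z))
    (hφL : ∀ y, LipschitzWith L (fun z => φ z y)) (hφC : ∀ y, |φ z₀ y| ≤ C)
    (T : Fin n → 𝒳 × 𝒴) : Continuous (ruleGap D φ T : (Fin d → Param p K) → ℝ) :=
  (LipschitzWith.of_dist_le_mul (K := ⟨4 * L * √d * (p * B + 1), by positivity⟩) fun θ θ' => by
    rw [Real.dist_eq, dist_eq_norm]
    exact abs_ruleGap_sub_ruleGap_le hn hB0 hB hφm hφL hφC T θ θ').continuous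

lemma measurable_ruleGap [NeZero K] {D : Measure (𝒳 × 𝒴)} (hφm : ∀ z, Measurable (φ z))
    (hφL : ∀ y, LipschitzWith L (fun z => φ z y)) (θ : Fin d → Param p K) :
    Measurable fun T : Fin n → 𝒳 × 𝒴 => ruleGap D φ T θ := by
  have h : ∀ s, Measurable fun T : Fin n → 𝒳 × 𝒴 => φ (rule 𝒳 θ (T s).1) (T s).2 := fun s =>
    (measurable_cost hφm hφL θ).comp (measurable_pi_apply s)
  exact (((Finset.measurable_sum _ fun s _ => h s).const_mul _).const_sub _).abs

lemma gaps_ruleClass (D : Measure (𝒳 × 𝒴)) {μ : ℝ} (hμ : 0 ≤ μ) (T : Fin n → 𝒳 × 𝒴) :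
    gaps D φ (ruleClass 𝒳 d K μ) T =
      ruleGap D φ T '' Metric.closedBall (0 : Fin d → Param p K) μ := by
  rw [gaps, ruleClass_eq_image 𝒳 hμ, Set.image_image]
  rfl

lemma isGreatest_uniformGap_of_continuous {D : Measure (𝒳 × 𝒴)} {μ : ℝ} (hμ : 0 ≤ μ)
    {T : Fin n → 𝒳 × 𝒴} (hc : Continuous (ruleGap D φ T : (Fin d → Param p K) → ℝ)) :
    IsGreatest (gaps D φ (ruleClass 𝒳 d K μ) T) (uniformGap D φ (ruleClass 𝒳 d K μ) T) := by
  unfold uniformGap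
  rw [gaps_ruleClass D hμ]
  exact ((isCompact_closedBall _ _).image hc).isGreatest_sSup
    ((Metric.nonempty_closedBall.2 hμ).image _)

lemma measurable_uniformGap [NeZero K] {D : Measure (𝒳 × 𝒴)} {μ : ℝ} (hμ : 0 ≤ μ)
    (hφm : ∀ z, Measurable (φ z)) (hφL : ∀ y, LipschitzWith L (fun z => φ z y))
    (hc : ∀ T : Fin n → 𝒳 × 𝒴, Continuous (ruleGap D φ T : (Fin d → Param p K) → ℝ)) :
    Measurable fun T : Fin n → 𝒳 × 𝒴 => uniformGap D φ (ruleClass 𝒳 d K μ) T := by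
  obtain ⟨A, hA, hAd⟩ :=
    TopologicalSpace.exists_countable_dense (Metric.closedBall (0 : Fin d → Param p K) μ)
  have := hA.to_subtype
  have e : (fun T : Fin n → 𝒳 × 𝒴 => uniformGap D φ (ruleClass 𝒳 d K μ) T) =
      fun T => ⨆ θ : A, ruleGap D φ T θ.1.1 := by
    funext T
    rw [uniformGap, gaps_ruleClass D hμ, sSup_image']
    exact (hAd.ciSup' ((hc T).comp continuous_subtype_val)).symm
  rw [e]
  exact Measurable.iSup fun θ => measurable_ruleGap hφm hφL _

end Cost

lemma sqrt_add_le_sqrt_add_sqrt {a b : ℝ} (ha : 0 ≤ a) (hb : 0 ≤ b) : √(a + b) ≤ √a + √b := by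
  refine Real.sqrt_le_iff.2 ⟨by positivity, ?_⟩
  rw [add_sq, Real.sq_sqrt ha, Real.sq_sqrt hb]
  have : 0 ≤ 2 * √a * √b := by positivity
  linarith

lemma sqrt_mul_add_one_le {p d K : ℕ} (hK : 1 ≤ K) {B : ℝ} :
    √d * (p * B + 1) ≤ √(2 * d * K * (p + 1) * (p * B ^ 2 + 1)) := by
  refine Real.le_sqrt_of_sq_le ?_
  rw [mul_pow, Real.sq_sqrt (Nat.cast_nonneg _)]
  have hK' : (1 : ℝ) ≤ K := by exact_mod_cast hK
  have h : (p * B + 1) ^ 2 ≤ (p + 1) * (p * B ^ 2 + 1) := by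
    nlinarith [mul_nonneg p.cast_nonneg (sq_nonneg (B - 1))]
  calc (d : ℝ) * (p * B + 1) ^ 2 ≤ d * ((p + 1) * (p * B ^ 2 + 1)) := by gcongr
    _ = 1 * (d * ((p + 1) * (p * B ^ 2 + 1))) := (one_mul _).symm
    _ ≤ (2 * K) * (d * ((p + 1) * (p * B ^ 2 + 1))) := by gcongr; linarith
    _ = _ := by ring

/-- The union bound for a Hoeffding tail over `n ^ N` events. -/
lemma pow_mul_exp_hoeffding {n N : ℕ} (hn : 1 ≤ n) {M δ : ℝ} (hM : 0 < M) (hδ : 0 < δ) (hδ1 : δ ≤ 1) :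
    (n : ℝ) ^ N * (2 * Real.exp (-(n * (√2 * M * √((N * Real.log n + Real.log (2 / δ)) / n)) ^ 2 /
      (2 * M ^ 2)))) = δ := by
  have hn0 : (0 : ℝ) < n := by exact_mod_cast hn
  have h1 : 0 ≤ Real.log n := Real.log_natCast_nonneg n
  have h2 : 0 ≤ Real.log (2 / δ) := Real.log_nonneg (by rw [le_div_iff₀ hδ]; linarith)
  have e : n * (√2 * M * √((N * Real.log n + Real.log (2 / δ)) / n)) ^ 2 / (2 * M ^ 2) =
      Real.log (n ^ N * (2 / δ)) := by
    rw [mul_pow, mul_pow, Real.sq_sqrt (by norm_num), Real.sq_sqrt (by positivity),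
      Real.log_mul (by positivity) (by positivity), Real.log_pow]
    field_simp
  rw [e, Real.exp_neg, Real.exp_log (by positivity)]
  field_simp

end PADR

theorem proposition2
    {Ω 𝒴 : Type*} [MeasurableSpace Ω] [MeasurableSpace 𝒴]
    {p d K n : ℕ} (hK : 1 ≤ K) (hn : 1 ≤ n)
    -- the compact feature set, with `max_{x ∈ 𝒳} ‖x‖_∞ = Xbar > 0`
    (𝒳 : Set (Fin p → ℝ)) (h𝒳 : IsCompact 𝒳) (Xbar : ℝ) (hXbar : 0 < Xbar)
    (hmax : IsGreatest ((fun x => ‖x‖) '' 𝒳) Xbar)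
    -- the joint law of `(X, Y)`
    (D : Measure (𝒳 × 𝒴)) [IsProbabilityMeasure D]
    -- the i.i.d. sample
    (P : Measure Ω) [IsProbabilityMeasure P]
    (S : Fin n → Ω → 𝒳 × 𝒴) (hSm : ∀ s, Measurable (S s))
    (hSlaw : ∀ s, P.map (S s) = D) (hSindep : iIndepFun S P)
    -- the cost function
    (φ : EuclideanSpace ℝ (Fin d) → 𝒴 → ℝ) (hφm : ∀ z, Measurable (φ z))
    (L : ℝ≥0) (hL : 0 < L) (hφL : ∀ y, LipschitzWith L (fun z => φ z y))
    (C : ℝ) (hC : 0 < C) (z₀ : EuclideanSpace ℝ (Fin d)) (hφC : ∀ y, |φ z₀ y| ≤ C)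
    (μ : ℝ) (hμ : 0 ≤ μ) (δ : ℝ) (hδ : 0 < δ) :
    -- the expected costs are well defined
    (∀ f ∈ PADR.ruleClass 𝒳 d K μ, Integrable (fun w : 𝒳 × 𝒴 => φ (f w.1) w.2) D) ∧
    -- the uniform gap is a maximum, whatever the sample is
    (∀ T : Fin n → 𝒳 × 𝒴,
      IsGreatest (PADR.gaps D φ (PADR.ruleClass 𝒳 d K μ) T)
        (PADR.uniformGap D φ (PADR.ruleClass 𝒳 d K μ) T)) ∧
    -- the uniform gap of the random sample is a random variable
    Measurable (fun ω => PADR.uniformGap D φ (PADR.ruleClass 𝒳 d K μ) (fun s => S s ω)) ∧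
    -- the bound, with probability at least `1 - δ`
    1 - δ ≤ P.real {ω |
      PADR.uniformGap D φ (PADR.ruleClass 𝒳 d K μ) (fun s => S s ω) ≤
        8 * μ * L * √(2 * d * K * (p + 1) * (p * Xbar ^ 2 + 1)) / n
        + 2 * PADR.costBound p d μ Xbar L C z₀ * √(2 * d * K * (p + 1) * Real.log n / n)
        + √2 * PADR.costBound p d μ Xbar L C z₀ * √(Real.log (2 / δ) / n)} := by
  have : NeZero K := ⟨by omega⟩
  have hn0 : (0 : ℝ) < n := by exact_mod_cast hn
  have hB : ∀ x ∈ 𝒳, ‖x‖ ≤ Xbar := fun x hx => hmax.2 ⟨x, hx, rfl⟩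
  have hc : ∀ T : Fin n → 𝒳 × 𝒴,
      Continuous (PADR.ruleGap D φ T : (Fin d → PADR.Param p K) → ℝ) :=
    PADR.continuous_ruleGap hn hXbar.le hB hφm hφL hφC
  have hmeas : Measurable
      (fun ω => PADR.uniformGap D φ (PADR.ruleClass 𝒳 d K μ) (fun s => S s ω)) :=
    (PADR.measurable_uniformGap hμ hφm hφL hc).comp (measurable_pi_lambda _ hSm)
  have hgr := fun T => PADR.isGreatest_uniformGap_of_continuous hμ (hc T)
  refine ⟨fun f hf => ?_, hgr, hmeas, ?_⟩
  · rw [PADR.ruleClass_eq_image 𝒳 hμ] at hf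
    obtain ⟨θ, -, rfl⟩ := hf
    exact PADR.integrable_cost hXbar.le hB hφm hφL hφC θ
  obtain hδ1 | hδ1 := le_total 1 δ
  · exact (sub_nonpos.2 hδ1).trans measureReal_nonneg
  set M := PADR.costBound p d μ Xbar L C z₀ with hMdef
  have hM : 0 < M := by rw [hMdef, PADR.costBound]; positivity
  obtain ⟨N, hN, c, hcμ, hcn⟩ : ∃ N, N = 2 * d * K * (p + 1) ∧
      ∃ c : Fin (n ^ N) → Fin d → PADR.Param p K,
        (∀ i, ‖c i‖ ≤ μ) ∧ ∀ θ, ‖θ‖ ≤ μ → ∃ i, ‖θ - c i‖ ≤ μ / n :=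
    ⟨_, rfl, PADR.exists_param_net hn hμ⟩
  set t := √2 * M * √((N * Real.log n + Real.log (2 / δ)) / n) with ht
  set b := 8 * μ * L * √(2 * d * K * (p + 1) * (p * Xbar ^ 2 + 1)) / n
    + 2 * M * √(2 * d * K * (p + 1) * Real.log n / n) + √2 * M * √(Real.log (2 / δ) / n) with hb
  have hlog : 0 ≤ Real.log n := Real.log_natCast_nonneg n
  have hlogδ : 0 ≤ Real.log (2 / δ) := Real.log_nonneg (by rw [le_div_iff₀ hδ]; linarith)
  have htail : t + 4 * L * √d * (p * Xbar + 1) * (μ / n) ≤ b := by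
    have h1 : 4 * L * √d * (p * Xbar + 1) * (μ / n) ≤
        8 * μ * L * √(2 * d * K * (p + 1) * (p * Xbar ^ 2 + 1)) / n := by
      have := PADR.sqrt_mul_add_one_le (p := p) (d := d) (B := Xbar) hK
      calc 4 * L * √d * (p * Xbar + 1) * (μ / n)
          = 4 * (μ * L * (√d * (p * Xbar + 1)) / n) := by ring
        _ ≤ 8 * (μ * L * √(2 * d * K * (p + 1) * (p * Xbar ^ 2 + 1)) / n) := by
            gcongr
            norm_num
        _ = _ := by ring
    have h2 : t ≤ 2 * M * √(2 * d * K * (p + 1) * Real.log n / n) +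
        √2 * M * √(Real.log (2 / δ) / n) := by
      have hs : √2 ≤ (2 : ℝ) := Real.sqrt_le_iff.2 (by norm_num)
      have hN' : (N : ℝ) = 2 * d * K * (p + 1) := by rw [hN]; push_cast; ring
      calc t ≤ √2 * M * (√(N * Real.log n / n) + √(Real.log (2 / δ) / n)) := by
            rw [ht, add_div]
            gcongr
            exact PADR.sqrt_add_le_sqrt_add_sqrt (by positivity) (by positivity)
        _ = √2 * M * √(N * Real.log n / n) + √2 * M * √(Real.log (2 / δ) / n) := mul_add _ _ _
        _ ≤ _ := by rw [hN']; gcongr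
    linarith
  have hbad : P.real {ω |
      PADR.uniformGap D φ (PADR.ruleClass 𝒳 d K μ) (fun s => S s ω) ≤ b}ᶜ ≤ δ := by
    calc P.real {ω | PADR.uniformGap D φ (PADR.ruleClass 𝒳 d K μ) (fun s => S s ω) ≤ b}ᶜ
        ≤ P.real (⋃ i, {ω | t ≤ PADR.ruleGap D φ (fun s => S s ω) (c i)}) := by
          refine measureReal_mono fun ω hω => ?_
          have hω' : b < PADR.uniformGap D φ (PADR.ruleClass 𝒳 d K μ) (fun s => S s ω) :=
            not_le.1 hω
          have hmem := (hgr fun s => S s ω).1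
          rw [PADR.gaps_ruleClass D hμ] at hmem
          obtain ⟨θ, hθ, hθe⟩ := hmem
          obtain ⟨i, hi⟩ := hcn θ (by simpa using hθ)
          have h1 := (abs_le.1 (PADR.abs_ruleGap_sub_ruleGap_le hn (D := D) hXbar.le hB hφm hφL hφC
            (fun s => S s ω) θ (c i))).2
          have h2 : 4 * L * √d * (p * Xbar + 1) * ‖θ - c i‖ ≤
            4 * L * √d * (p * Xbar + 1) * (μ / n) := by gcongr
          refine Set.mem_iUnion.2 ⟨i, ?_⟩
          rw [Set.mem_ofPred_eq]
          linarith
      _ ≤ ∑ i, P.real {ω | t ≤ PADR.ruleGap D φ (fun s => S s ω) (c i)} :=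
          measureReal_iUnion_fintype_le _
      _ ≤ ∑ _i : Fin (n ^ N), 2 * Real.exp (-(n * t ^ 2 / (2 * M ^ 2))) :=
          Finset.sum_le_sum fun i _ => PADR.measureReal_le_abs_integral_sub_mean_le hn hSm hSlaw
            hSindep (PADR.measurable_cost hφm hφL (c i)) hM
            (PADR.abs_cost_le hXbar.le hB hφL hφC (hcμ i)) (by positivity)
      _ = δ := by
          rw [Finset.sum_const, Finset.card_univ, Fintype.card_fin, nsmul_eq_mul, Nat.cast_pow]
          exact PADR.pow_mul_exp_hoeffding hn hM hδ hδ1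
  rw [probReal_compl_eq_one_sub (measurableSet_le hmeas measurable_const)] at hbad
  linarith
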